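/- For $r,d\ge 2$ let $F=F(x_1,\dots,x_r)$ be the free group, $F^{(d)}$ its $d$-th derived subgroup, and $S_{r,d}=F/F^{(d)}$ the free solvable group of rank $r$ and class $d$. For a word $w=x_{i_1}^{\varepsilon_1}\cdots x_{i_n}^{\varepsilon_n}$ ($\varepsilon_j=\pm1$) put $|w|=n$, let $w_j$ be its prefix of length $j$, and let $D_w=\{w_0,\dots,w_n\}$. The $S_{r,d}$-partition function $P$ of $D_w$ sends $j\in\{0,\dots,n\}$ to the smallest $i$ with $w_i=w_j$ in $S_{r,d}$. Let $\partial/\partial x_k$ be the Fox derivative, i.e. the unique additive map on $\mathbb ZF$ with $\partial(uv)/\partial x_k=(\partial u/\partial x_k)\,v^{\varepsilon}+u\,\partial v/\partial x_k$ (where $v^{\varepsilon}$ is the augmentation of $v$) and $\partial x_j/\partial x_k=\delta_{jk}$; we also write $\partial w/\partial x_k$ for its image in $\mathbb ZS_{r,d}$. The standard group ring form of an element of $\mathbb ZS_{r,d}$ is its expression $\sum_g m_g g$ with pairwise distinct $g\in S_{r,d}$ and coefficients $m_g\neq0$; below, each $g$ that occurs is given by the length $j$ of a prefix $w_j$ of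 $w$ representing it. Let $M(S_{r,d})$ be the group of matrices $\begin{pmatrix} g&t\\0&1\end{pmatrix}$ with $g\in S_{r,d}$ and $t$ in the free left $\mathbb ZS_{r,d}$-module with basis $t_1,\dots,t_r$, and let the Magnus embedding $\psi:S_{r,d+1}\to M(S_{r,d})$ be the homomorphism induced by $x_i\mapsto\begin{pmatrix} x_i&t_i\\0&1\end{pmatrix}$. Computations are carried out by a random access machine with integer variables and integer arrays, whose elementary steps are assignment of a constant or a variable, adding or subtracting $1$, reading or writing one array cell, and comparing two variables. Each of the following tasks is performed by one fixed program, the same for all inputs, within at most $C\,d\,r\,\max(1,|w|)^3$ elementary steps for some constant $C$ independent of the input; that is, in time $O(d\,r\,|w|^3)$: 1. given integers $r,d\ge2$ and a word $w$, compute the $S_{r,d}$-partition function of $D_w$; 2. given integers $r,d\ge 2$, a word $w$ and $k\in\{1,\dots,r\}$, compute the standard group ring form of $\partial w/\partial x_k$ in $\mathbb ZS_{r,d}$; 3. given integers $r,d\ge2$ and a word $w$, compute the image of $w$ under the Magnus embedding $\psi:S_{r,d+1}\to M(S_{r,d})$, that is, a prefix of $w$ representing its diagonal entry in $S_{r,d}$,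 and the standard group ring forms of the $r$ coordinates of its corner entry with respect to $t_1,\dots,t_r$. -/

import Mathlib

noncomputable section

namespace FoxComplexity

/-! ### Machine model: programs over integer variables and integer arrays, unit cost.

A program is a finite text and so mentions finitely many variables and arrays; array cells are
accessed indirectly. The only arithmetic is adding or subtracting one, so every number that occurs
is bounded by the size of the inputs and program constants plus the number of steps. -/

/-- A memory: integer variables, and integer arrays whose cells are numbered `0, 1, 2, …`. -/
structure Memory where
  var : ℕ → ℤ
  arr : ℕ → ℕ → ℤ

/-- `m.setVar x c` is the memory `m` after `x := c`. -/
def Memory.setVar (m : Memory) (x : ℕ) (c : ℤ) : Memory where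
  var := Function.update m.var x c
  arr := m.arr

/-- `m.setCell A j c` is the memory `m` after `A[j] := c`. -/
def Memory.setCell (m : Memory) (A j : ℕ) (c : ℤ) : Memory where
  var := m.var
  arr := Function.update m.arr A (Function.update (m.arr A) j c)

/-- Tests: comparison of the values of two variables. -/
inductive Test where
  | eq (x y : ℕ)
  | lt (x y : ℕ)

/-- The truth value of a test. -/
def Test.Holds : Test → Memory → Prop
  | .eq x y, m => m.var x = m.var y
  | .lt x y, m => m.var x < m.var y

/-- Programs. Variables `x`, `y` and arrays `A` are given by their numbers. -/
inductive Prog where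
  /-- do nothing -/
  | skip
  /-- `x := c`, a fixed integer constant -/
  | const (x : ℕ) (c : ℤ)
  /-- `x := y` -/
  | copy (x y : ℕ)
  /-- `x := x + 1` -/
  | inc (x : ℕ)
  /-- `x := x - 1` -/
  | dec (x : ℕ)
  /-- `x := A[y]` -/
  | load (x A y : ℕ)
  /-- `A[x] := y` -/
  | store (A x y : ℕ)
  /-- `p; q` -/
  | seq (p q : Prog)
  /-- `if b then p else q` -/
  | ite (b : Test) (p q : Prog)
  /-- `while b do p` -/
  | loop (b : Test) (p : Prog)

/-- `Exec p m t m'`: started in memory `m`, the program `p` halts after exactly `t` elementary steps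
in memory `m'`. Each basic instruction and each evaluation of a test is one step. An access to an
array cell with a negative number has no rule, so the program does not halt properly then. -/
inductive Exec : Prog → Memory → ℕ → Memory → Prop where
  | skip (m) : Exec .skip m 1 m
  | const (m x c) : Exec (.const x c) m 1 (m.setVar x c)
  | copy (m x y) : Exec (.copy x y) m 1 (m.setVar x (m.var y))
  | inc (m x) : Exec (.inc x) m 1 (m.setVar x (m.var x + 1))
  | dec (m x) : Exec (.dec x) m 1 (m.setVar x (m.var x - 1))
  | load (m x A y) (j : ℕ) (hj : m.var y = (j : ℤ)) :
      Exec (.load x A y) m 1 (m.setVar x (m.arr A j))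
  | store (m A x y) (j : ℕ) (hj : m.var x = (j : ℤ)) :
      Exec (.store A x y) m 1 (m.setCell A j (m.var y))
  | seq {p q m t m' t' m''} (hp : Exec p m t m') (hq : Exec q m' t' m'') :
      Exec (.seq p q) m (t + t') m''
  | ite_true {b p q m t m'} (hb : b.Holds m) (hp : Exec p m t m') :
      Exec (.ite b p q) m (t + 1) m'
  | ite_false {b p q m t m'} (hb : ¬ b.Holds m) (hq : Exec q m t m') :
      Exec (.ite b p q) m (t + 1) m'
  | loop_false {b p m} (hb : ¬ b.Holds m) : Exec (.loop b p) m 1 m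
  | loop_true {b p m t m' t' m''} (hb : b.Holds m) (hp : Exec p m t m')
      (hl : Exec (.loop b p) m' t' m'') : Exec (.loop b p) m (t + t' + 1) m''

/-- Words in the letters `x_i` (`(i, true)`) and `x_i⁻¹` (`(i, false)`), not necessarily reduced. -/
abbrev Word (r : ℕ) := List (Fin r × Bool)

/-- The input memory: variables `0, 1, 2, 3` hold `r`, `d`, `|w|` and a further number `k`;
arrays `0` and `1` hold the indices and the exponents `±1` of the letters of `w`;
everything else is `0`. -/
def input (r d : ℕ) (w : Word r) (k : ℕ) : Memory where
  var x := if x = 0 then r else if x = 1 then d else if x = 2 then w.length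
    else if x = 3 then k else 0
  arr A j := match w[j]? with
    | none => 0
    | some (i, e) => if A = 0 then (i : ℕ) else if A = 1 then (if e then 1 else -1) else 0

/-! ### Free solvable groups, Fox derivatives, the Magnus embedding -/

/-- The free solvable group `F / F^(d)` of rank `r` and class `d`. -/
abbrev FreeSolvable (r d : ℕ) : Type :=
  FreeGroup (Fin r) ⧸ derivedSeries (FreeGroup (Fin r)) d

instance derivedSeriesNormal (G : Type*) [Group G] (d : ℕ) : (derivedSeries G d).Normal :=
  derivedSeries_normal G d

/-- The canonical epimorphism from the free group to the free solvable group. -/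
def toFreeSolvable (r d : ℕ) : FreeGroup (Fin r) →* FreeSolvable r d :=
  QuotientGroup.mk' (derivedSeries (FreeGroup (Fin r)) d)

/-- The integral group ring. -/
abbrev GroupRing (G : Type*) [Group G] := MonoidAlgebra ℤ G

/-- The matrices `(g t; 0 1)` with `g` in a group `G` and `t` in a left `ℤG`-module `T`. -/
@[ext] structure TriMatrix (G T : Type*) where
  diag : G
  corner : T

namespace TriMatrix

variable {G T : Type*} [Group G] [AddCommGroup T] [Module (GroupRing G) T]

/-- Matrix multiplication: `(g t; 0 1) (h s; 0 1) = (gh, g s + t; 0 1)`. -/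
instance : Mul (TriMatrix G T) :=
  ⟨fun a b => ⟨a.diag * b.diag, MonoidAlgebra.of ℤ G a.diag • b.corner + a.corner⟩⟩

instance : One (TriMatrix G T) := ⟨⟨1, 0⟩⟩

instance : Inv (TriMatrix G T) :=
  ⟨fun a => ⟨a.diag⁻¹, -(MonoidAlgebra.of ℤ G a.diag⁻¹ • a.corner)⟩⟩

theorem diag_mul (a b : TriMatrix G T) : (a * b).diag = a.diag * b.diag := rfl

theorem corner_mul (a b : TriMatrix G T) :
    (a * b).corner = MonoidAlgebra.of ℤ G a.diag • b.corner + a.corner := rfl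

set_option linter.unusedSectionVars false

theorem diag_one : (1 : TriMatrix G T).diag = 1 := rfl

theorem corner_one : (1 : TriMatrix G T).corner = 0 := rfl

theorem diag_inv (a : TriMatrix G T) : (a⁻¹).diag = a.diag⁻¹ := rfl

theorem corner_inv (a : TriMatrix G T) :
    (a⁻¹).corner = -(MonoidAlgebra.of ℤ G a.diag⁻¹ • a.corner) := rfl

instance : Group (TriMatrix G T) :=
  Group.ofLeftAxioms
    (fun a b c => by
      ext
      · simp only [diag_mul, mul_assoc]
      · simp only [diag_mul, corner_mul, map_mul, smul_add, mul_smul, add_assoc])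
    (fun a => by
      ext
      · simp only [diag_mul, diag_one, one_mul]
      · simp only [corner_mul, diag_one, corner_one, map_one, one_smul, add_zero])
    (fun a => by
      ext
      · simp only [diag_mul, diag_inv, diag_one, inv_mul_cancel]
      · simp only [corner_mul, diag_inv, corner_inv, corner_one, add_neg_cancel])

end TriMatrix

/-- `u ↦ (u, ∂u/∂x_k; 0 1)` on the free group, given by `x_j ↦ (x_j, δ_{jk}; 0 1)`. -/
def foxMatrix {r : ℕ} (k : Fin r) :
    FreeGroup (Fin r) →* TriMatrix (FreeGroup (Fin r)) (GroupRing (FreeGroup (Fin r))) :=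
  FreeGroup.lift fun j => ⟨FreeGroup.of j, if j = k then 1 else 0⟩

/-- The Fox derivative `∂/∂x_k` of the integral group ring of the free group. The lemmas below show
that it is the unique derivation with `∂x_j/∂x_k = δ_{jk}`. -/
def foxDeriv {r : ℕ} (k : Fin r) :
    GroupRing (FreeGroup (Fin r)) →+ GroupRing (FreeGroup (Fin r)) :=
  (Finsupp.liftAddHom fun g => zmultiplesHom _ (foxMatrix k g).corner).comp
    (MonoidAlgebra.coeffAddEquiv).toAddMonoidHom

/-- The augmentation `ℤG → ℤ`. -/
def augmentation (G : Type*) [Group G] : GroupRing G →ₐ[ℤ] ℤ := MonoidAlgebra.lift ℤ ℤ G 1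

theorem diag_foxMatrix {r : ℕ} (k : Fin r) (g : FreeGroup (Fin r)) : (foxMatrix k g).diag = g := by
  let π : TriMatrix (FreeGroup (Fin r)) (GroupRing (FreeGroup (Fin r))) →* FreeGroup (Fin r) :=
    ⟨⟨TriMatrix.diag, rfl⟩, fun _ _ => rfl⟩
  have h : π.comp (foxMatrix k) = MonoidHom.id _ := by
    ext j
    simp [π, foxMatrix]
  exact DFunLike.congr_fun h g

theorem foxDeriv_single {r : ℕ} (k : Fin r) (g : FreeGroup (Fin r)) (m : ℤ) :
    foxDeriv k (MonoidAlgebra.single g m) = m • (foxMatrix k g).corner := by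
  simp [foxDeriv]

theorem foxDeriv_generator {r : ℕ} (k j : Fin r) :
    foxDeriv k (MonoidAlgebra.of ℤ _ (FreeGroup.of j)) = if j = k then 1 else 0 := by
  rw [MonoidAlgebra.of_apply, foxDeriv_single]
  simp [foxMatrix]

theorem foxDeriv_mul {r : ℕ} (k : Fin r) (u v : GroupRing (FreeGroup (Fin r))) :
    foxDeriv k (u * v) = augmentation _ v • foxDeriv k u + u * foxDeriv k v := by
  induction u using MonoidAlgebra.induction_linear with
  | zero => simp
  | add a b ha hb => rw [add_mul, map_add, ha, hb, map_add, smul_add, add_mul]; abel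
  | single g m =>
    induction v using MonoidAlgebra.induction_linear with
    | zero => simp
    | add a b ha hb => rw [mul_add, map_add, ha, hb, map_add, map_add, add_smul, mul_add]; abel
    | single h n =>
      have e : MonoidAlgebra.single g m = m • MonoidAlgebra.of ℤ (FreeGroup (Fin r)) g := by
        simp
      rw [MonoidAlgebra.single_mul_single, foxDeriv_single, foxDeriv_single, foxDeriv_single,
        map_mul, TriMatrix.corner_mul, diag_foxMatrix, e]
      simp only [augmentation, MonoidAlgebra.lift_single, smul_add, MonoidHom.one_apply,
        smul_eq_mul, mul_one, smul_mul_smul_comm, smul_smul]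
      rw [add_comm, mul_comm n m]

theorem foxDeriv_unique {r : ℕ} (k : Fin r)
    (D : GroupRing (FreeGroup (Fin r)) →+ GroupRing (FreeGroup (Fin r)))
    (hmul : ∀ u v, D (u * v) = augmentation _ v • D u + u * D v)
    (hgen : ∀ j, D (MonoidAlgebra.of ℤ _ (FreeGroup.of j)) = if j = k then 1 else 0) :
    D = foxDeriv k := by
  let Φ : FreeGroup (Fin r) →* TriMatrix (FreeGroup (Fin r)) (GroupRing (FreeGroup (Fin r))) :=
    MonoidHom.mk' (fun g => ⟨g, D (MonoidAlgebra.of ℤ _ g)⟩) fun g h => by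
      ext1
      · rfl
      · show D _ = MonoidAlgebra.of ℤ _ g • D _ + D _
        rw [map_mul, hmul]
        simp [augmentation, add_comm]
  have hΦ : Φ = foxMatrix k := by
    ext1 j
    have : Φ (FreeGroup.of j) = ⟨FreeGroup.of j, if j = k then 1 else 0⟩ := by
      simp only [← hgen j]; rfl
    rw [this]; simp [foxMatrix]
  refine AddMonoidHom.ext fun u => ?_
  induction u using MonoidAlgebra.induction_linear with
  | zero => simp
  | add a b ha hb => rw [map_add, map_add, ha, hb]
  | single g m =>
    have e : MonoidAlgebra.single g m = m • MonoidAlgebra.of ℤ (FreeGroup (Fin r)) g := by simp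
    have h1 : D (MonoidAlgebra.of ℤ _ g) = (foxMatrix k g).corner := by rw [← hΦ]; rfl
    rw [foxDeriv_single, e, map_zsmul, h1]

/-- The induced derivative `∂w/∂x_k` in the group ring of the free solvable group. -/
def foxDerivSolvable {r : ℕ} (d : ℕ) (k : Fin r) (u : FreeGroup (Fin r)) :
    GroupRing (FreeSolvable r d) :=
  MonoidAlgebra.mapDomainRingHom ℤ (toFreeSolvable r d) (foxDeriv k (MonoidAlgebra.of ℤ _ u))

/-- The group `M(S_{r,d})` of matrices `(g t; 0 1)` with `g ∈ S_{r,d}` and `t` in the free left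
`ℤS_{r,d}`-module with basis `t_1, …, t_r`. -/
abbrev MagnusGroup (r d : ℕ) : Type :=
  TriMatrix (FreeSolvable r d) (Fin r → GroupRing (FreeSolvable r d))

/-- The homomorphism `φ : F → M(S_{r,d})`, `x_i ↦ (x_i t_i; 0 1)`. -/
def magnusHom (r d : ℕ) : FreeGroup (Fin r) →* MagnusGroup r d :=
  FreeGroup.lift fun i => ⟨toFreeSolvable r d (FreeGroup.of i), Pi.single i 1⟩

theorem diag_magnusHom (r d : ℕ) (u : FreeGroup (Fin r)) :
    (magnusHom r d u).diag = toFreeSolvable r d u := by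
  let π : MagnusGroup r d →* FreeSolvable r d := ⟨⟨TriMatrix.diag, rfl⟩, fun _ _ => rfl⟩
  have h : π.comp (magnusHom r d) = toFreeSolvable r d := by
    ext j
    simp [π, magnusHom]
  exact DFunLike.congr_fun h u

theorem derivedSeries_succ_le_ker (r d : ℕ) :
    derivedSeries (FreeGroup (Fin r)) (d + 1) ≤ (magnusHom r d).ker := by
  rw [derivedSeries_succ, Subgroup.commutator_le]
  intro a ha b hb
  have key : ∀ c ∈ derivedSeries (FreeGroup (Fin r)) d, (magnusHom r d c).diag = 1 := by
    intro c hc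
    rw [diag_magnusHom]
    exact (QuotientGroup.eq_one_iff c).2 hc
  rw [MonoidHom.mem_ker, map_commutatorElement, commutatorElement_eq_one_iff_mul_comm]
  ext1
  · rw [TriMatrix.diag_mul, TriMatrix.diag_mul, key a ha, key b hb]
  · rw [TriMatrix.corner_mul, TriMatrix.corner_mul, key a ha, key b hb, map_one, one_smul,
      one_smul, add_comm]

/-- The Magnus embedding `ψ : S_{r,d+1} = F/N' → M(F/N)`, where `N = F^(d)`. -/
def magnusEmbedding (r d : ℕ) : FreeSolvable r (d + 1) →* MagnusGroup r d :=
  QuotientGroup.lift (derivedSeries (FreeGroup (Fin r)) (d + 1)) (magnusHom r d)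
    (derivedSeries_succ_le_ker r d)

/-! ### Partitions of the set of prefixes and standard group ring forms -/

/-- The element of `S_{r,d}` represented by the prefix `w_j` of length `j` of `w`. -/
def prefixElt {r : ℕ} (d : ℕ) (w : Word r) (j : ℕ) : FreeSolvable r d :=
  toFreeSolvable r d (FreeGroup.mk (w.take j))

/-- `P : {0, …, |w|} → {0, …, |w|}` is the `S_{r,d}`-partition function of the ordered set
`w_0, …, w_{|w|}` of prefixes of `w`: `P j` is the smallest `i` with `w_i = w_j` in `S_{r,d}`. -/
def IsPartition {r : ℕ} (d : ℕ) (w : Word r) (P : ℕ → ℕ) : Prop :=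
  ∀ j ≤ w.length, IsLeast {i | i ≤ w.length ∧ prefixElt d w i = prefixElt d w j} (P j)

/-- A list of pairs `(m, j)`, read as the formal sum of the `m • w_j`, is the standard group ring
form of `a`: the coefficients `m` are nonzero, the group elements represented by the prefixes `w_j`
are pairwise distinct, and the sum is `a`. -/
def IsStandardForm {r : ℕ} (d : ℕ) (w : Word r) (L : List (ℤ × ℕ))
    (a : GroupRing (FreeSolvable r d)) : Prop :=
  (∀ p ∈ L, p.1 ≠ 0 ∧ p.2 ≤ w.length) ∧
  (L.map fun p => prefixElt d w p.2).Nodup ∧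
  (L.map fun p => MonoidAlgebra.single (prefixElt d w p.2) p.1).sum = a

/-- The cells `lo, …, hi - 1` of the arrays `3` and `4` hold the coefficients and the prefix
lengths of a standard group ring form of `a`. -/
def HoldsStandardForm {r : ℕ} (d : ℕ) (w : Word r) (m : Memory) (lo hi : ℤ)
    (a : GroupRing (FreeSolvable r d)) : Prop :=
  ∃ (s : ℕ) (L : List (ℤ × ℕ)), lo = s ∧ hi = s + L.length ∧ IsStandardForm d w L a ∧
    ∀ (t : ℕ) (ht : t < L.length), m.arr 3 (s + t) = L[t].1 ∧ m.arr 4 (s + t) = L[t].2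

/-- Output convention for the partition: array `2` holds `P 0, …, P |w|`. -/
def OutputsPartition {r : ℕ} (d : ℕ) (w : Word r) (m : Memory) : Prop :=
  ∃ P : ℕ → ℕ, IsPartition d w P ∧ ∀ j ≤ w.length, m.arr 2 j = P j

/-- Output convention for a Fox derivative: variable `4` holds the number of terms, which are listed
from cell `0` on. -/
def OutputsFoxDeriv {r : ℕ} (d : ℕ) (w : Word r) (k : Fin r) (m : Memory) : Prop :=
  HoldsStandardForm d w m 0 (m.var 4) (foxDerivSolvable d k (FreeGroup.mk w))

/-- Output convention for a matrix `(g t; 0 1)` in `M(S_{r,d})`: variable `5` holds the length of a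
prefix of `w` that represents `g`; the standard form of the coordinate of `t` at the `i`-th basis
element occupies the cells from the value of cell `i` of array `5` up to, exclusively, the value of
its cell `i + 1`. -/
def OutputsMatrix {r d : ℕ} (w : Word r) (A : MagnusGroup r d) (m : Memory) : Prop :=
  (∃ j : ℕ, j ≤ w.length ∧ m.var 5 = j ∧ prefixElt d w j = A.diag) ∧
  ∀ i : Fin r, HoldsStandardForm d w m (m.arr 5 i) (m.arr 5 (i + 1)) (A.corner i)

/-- `p`, started on `m`, halts after at most `T` steps in a memory that satisfies `Q`. -/
def HaltsWithin (p : Prog) (m : Memory) (T : ℕ) (Q : Memory → Prop) : Prop :=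
  ∃ (t : ℕ) (m' : Memory), Exec p m t m' ∧ t ≤ T ∧ Q m'

end FoxComplexity

end

/-! Write N = F^(d). Two words are equal in F/N' exactly when their images in M(F/N) agree
(`ker_magnusHom`). The corner entry of the image of a word counts the signed passages of its path
through the edges of the Cayley graph of F/N: the coefficient of g in the k-th coordinate is the
flow through the edge labelled k that starts at g (`coeff_corner_magnusHom_take`). All prefixes of w
have zero flow through edges that w never traverses. Hence two prefixes agree in class d + 1 iff
they agree in class d and have equal flow through each of the at most |w| edges traversed by w
(`prefixElt_succ_eq_iff`).

Injectivity is proved with Schreier elements. A section s of F → F/N gives s(g) u s(gu)⁻¹ in N, and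
its class in N/N' is an additive function of g times the corner entry of u (`schreierHom_corner`).
If u lies in the kernel, the case g = 1 puts u itself in N'.

A vertex of the path is named by the least prefix length representing it, so flows are computed from
the class-d partition alone, without group elements. Class 0 is trivial and its partition is
constantly 0. To gain one class, the partition is refined by the flow through each traversed edge in
turn: |w| refinements at O(|w|²) steps each, hence O(d|w|³) in all. Given the class-d partition, the
coefficient of a Fox derivative at a vertex is a single flow of the whole word, so one derivative
costs O(|w|²) more and all r coordinates O(r|w|²). -/

noncomputable section

namespace FoxComplexity

/-! ### Reasoning about programs -/

namespace Prog

/-- `p` contains no assignment to the variable `x`. -/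
def keepsVar (x : ℕ) : Prog → Bool
  | skip => true
  | const y _ => x != y
  | copy y _ => x != y
  | inc y => x != y
  | dec y => x != y
  | load y _ _ => x != y
  | store _ _ _ => true
  | seq p q => keepsVar x p && keepsVar x q
  | ite _ p q => keepsVar x p && keepsVar x q
  | loop _ p => keepsVar x p

/-- `p` contains no assignment to a cell of the array `A`. -/
def keepsArr (A : ℕ) : Prog → Bool
  | skip => true
  | const _ _ => true
  | copy _ _ => true
  | inc _ => true
  | dec _ => true
  | load _ _ _ => true
  | store B _ _ => A != B
  | seq p q => keepsArr A p && keepsArr A q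
  | ite _ p q => keepsArr A p && keepsArr A q
  | loop _ p => keepsArr A p

/-- The programs of a list, one after the other. -/
def block : List Prog → Prog
  | [] => skip
  | p :: l => seq p (block l)

/-- `for i = 0, …, N - 1 do p` -/
def forUp (i N : ℕ) (p : Prog) : Prog :=
  seq (const i 0) (loop (.lt i N) (seq p (inc i)))

/-- `for i = N - 1, …, 0 do p`, where the variable `z` is expected to hold `0`. -/
def forDown (i N z : ℕ) (p : Prog) : Prog :=
  seq (copy i N) (loop (.lt z i) (seq (dec i) p))

end Prog

open Prog

/-! ### Memory updates and the frame property -/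

@[simp] theorem Memory.setVar_var (m : Memory) (x : ℕ) (c : ℤ) (y : ℕ) :
    (m.setVar x c).var y = if y = x then c else m.var y := by
  simp [Memory.setVar, Function.update_apply]

@[simp] theorem Memory.setVar_arr (m : Memory) (x : ℕ) (c : ℤ) : (m.setVar x c).arr = m.arr := rfl

@[simp] theorem Memory.setCell_var (m : Memory) (A j : ℕ) (c : ℤ) :
    (m.setCell A j c).var = m.var := rfl

@[simp] theorem Memory.setCell_arr (m : Memory) (A j : ℕ) (c : ℤ) (B i : ℕ) :
    (m.setCell A j c).arr B i = if B = A ∧ i = j then c else m.arr B i := by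
  simp only [Memory.setCell, Function.update_apply]
  by_cases hB : B = A
  · subst hB
    simp [Function.update_apply]
  · simp [hB]

/-- The memories `m` and `m'` agree on the variables and arrays to which `p` does not write. -/
structure SameOff (p : Prog) (m m' : Memory) : Prop where
  var : ∀ x, p.keepsVar x = true → m'.var x = m.var x
  arr : ∀ A, p.keepsArr A = true → m'.arr A = m.arr A

theorem SameOff.refl (p : Prog) (m : Memory) : SameOff p m m := ⟨fun _ _ => rfl, fun _ _ => rfl⟩

theorem SameOff.trans {p : Prog} {m m' m'' : Memory} (h : SameOff p m m') (h' : SameOff p m' m'') :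
    SameOff p m m'' :=
  ⟨fun x hx => (h'.var x hx).trans (h.var x hx), fun A hA => (h'.arr A hA).trans (h.arr A hA)⟩

theorem SameOff.weaken {p q : Prog} {m m' : Memory} (h : SameOff p m m')
    (hv : ∀ x, q.keepsVar x = true → p.keepsVar x = true)
    (ha : ∀ A, q.keepsArr A = true → p.keepsArr A = true) : SameOff q m m' :=
  ⟨fun x hx => h.var x (hv x hx), fun A hA => h.arr A (ha A hA)⟩

/-- The frame property. For a concrete program the syntactic conditions evaluate, so later side
goals about untouched cells close by `rfl`. -/
theorem Exec.sameOff {p : Prog} {m m' : Memory} {t : ℕ} (h : Exec p m t m') : SameOff p m m' := by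
  induction h with
  | skip m => exact .refl _ _
  | const | copy | inc | dec | load =>
    refine ⟨fun x hx => ?_, fun A _ => rfl⟩
    rw [Memory.setVar_var, if_neg (by simpa [keepsVar] using hx)]
  | store m A x y j hj =>
    refine ⟨fun x _ => rfl, fun B hB => ?_⟩
    have : B ≠ A := by simpa [keepsArr] using hB
    funext i
    simp [this]
  | seq _ _ h1 h2 =>
    exact (h1.weaken (by simp +contextual [keepsVar]) (by simp +contextual [keepsArr])).trans
      (h2.weaken (by simp +contextual [keepsVar]) (by simp +contextual [keepsArr]))
  | ite_true _ _ h1 =>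
    exact h1.weaken (by simp +contextual [keepsVar]) (by simp +contextual [keepsArr])
  | ite_false _ _ h1 =>
    exact h1.weaken (by simp +contextual [keepsVar]) (by simp +contextual [keepsArr])
  | loop_false => exact .refl _ _
  | loop_true _ _ _ h1 h2 =>
    exact (SameOff.weaken (q := .loop _ _) h1 (fun _ h => h) (fun _ h => h)).trans h2

/-! ### Hoare rules with time bounds -/

namespace HaltsWithin

variable {p q : Prog} {l : List Prog} {m : Memory} {T T₁ T₂ : ℕ} {Q R : Memory → Prop}

/-- The rule of consequence; the new postcondition may also use that cells not written by `p` are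
unchanged. -/
theorem mono (h : HaltsWithin p m T₁ R) (hT : T₁ ≤ T) (hQ : ∀ m', SameOff p m m' → R m' → Q m') :
    HaltsWithin p m T Q := by
  obtain ⟨t, m', he, ht, hR⟩ := h
  exact ⟨t, m', he, ht.trans hT, hQ m' he.sameOff hR⟩

theorem seq (h : HaltsWithin p m T₁ R)
    (h' : ∀ m', SameOff p m m' → R m' → HaltsWithin q m' T₂ Q) :
    HaltsWithin (.seq p q) m (T₁ + T₂) Q := by
  obtain ⟨t, m', he, ht, hR⟩ := h
  obtain ⟨t', m'', he', ht', hQ⟩ := h' m' he.sameOff hR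
  exact ⟨t + t', m'', .seq he he', Nat.add_le_add ht ht', hQ⟩

theorem skip (h : Q m) : HaltsWithin .skip m (T + 1) Q := ⟨1, m, .skip m, by omega, h⟩

theorem inc {x : ℕ} (h : Q (m.setVar x (m.var x + 1))) : HaltsWithin (.inc x) m (T + 1) Q :=
  ⟨1, _, .inc m x, by omega, h⟩

theorem dec {x : ℕ} (h : Q (m.setVar x (m.var x - 1))) : HaltsWithin (.dec x) m (T + 1) Q :=
  ⟨1, _, .dec m x, by omega, h⟩

theorem copy {x y : ℕ} (h : Q (m.setVar x (m.var y))) : HaltsWithin (.copy x y) m (T + 1) Q :=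
  ⟨1, _, .copy m x y, by omega, h⟩

theorem const {x : ℕ} {c : ℤ} (h : Q (m.setVar x c)) : HaltsWithin (.const x c) m (T + 1) Q :=
  ⟨1, _, .const m x c, by omega, h⟩

theorem load {x A y : ℕ} (j : ℕ) (hj : m.var y = j) (h : Q (m.setVar x (m.arr A j))) :
    HaltsWithin (.load x A y) m (T + 1) Q :=
  ⟨1, _, .load m x A y j hj, by omega, h⟩

theorem store {A x y : ℕ} (j : ℕ) (hj : m.var x = j) (h : Q (m.setCell A j (m.var y))) :
    HaltsWithin (.store A x y) m (T + 1) Q :=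
  ⟨1, _, .store m A x y j hj, by omega, h⟩

theorem ite {b : Test} (h : b.Holds m → HaltsWithin p m T Q)
    (h' : ¬ b.Holds m → HaltsWithin q m T Q) : HaltsWithin (.ite b p q) m (T + 1) Q := by
  by_cases hb : b.Holds m
  · obtain ⟨t, m', he, ht, hQ⟩ := h hb
    exact ⟨t + 1, m', .ite_true hb he, by omega, hQ⟩
  · obtain ⟨t, m', he, ht, hQ⟩ := h' hb
    exact ⟨t + 1, m', .ite_false hb he, by omega, hQ⟩

theorem nil (h : Q m) : HaltsWithin (block []) m (T + 1) Q := skip h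

theorem cons (h : HaltsWithin p m T₁ R)
    (h' : ∀ m', SameOff p m m' → R m' → HaltsWithin (block l) m' T₂ Q) :
    HaltsWithin (block (p :: l)) m (T₁ + T₂) Q := seq h h'

theorem inc_cons {x : ℕ} (h : HaltsWithin (block l) (m.setVar x (m.var x + 1)) T Q) :
    HaltsWithin (block (.inc x :: l)) m (T + 1) Q := by
  rw [add_comm]
  exact cons (T₁ := 1) (R := (· = _)) (inc (T := 0) rfl) (by rintro _ - rfl; exact h)

theorem copy_cons {x y : ℕ} (h : HaltsWithin (block l) (m.setVar x (m.var y)) T Q) :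
    HaltsWithin (block (.copy x y :: l)) m (T + 1) Q := by
  rw [add_comm]
  exact cons (T₁ := 1) (R := (· = _)) (copy (T := 0) rfl) (by rintro _ - rfl; exact h)

theorem const_cons {x : ℕ} {c : ℤ} (h : HaltsWithin (block l) (m.setVar x c) T Q) :
    HaltsWithin (block (.const x c :: l)) m (T + 1) Q := by
  rw [add_comm]
  exact cons (T₁ := 1) (R := (· = _)) (const (T := 0) rfl) (by rintro _ - rfl; exact h)

theorem load_cons {x A y : ℕ} (j : ℕ) (hj : m.var y = j)
    (h : HaltsWithin (block l) (m.setVar x (m.arr A j)) T Q) :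
    HaltsWithin (block (.load x A y :: l)) m (T + 1) Q := by
  rw [add_comm]
  exact cons (T₁ := 1) (R := (· = _)) (load (T := 0) j hj rfl) (by rintro _ - rfl; exact h)

theorem store_cons {A x y : ℕ} (j : ℕ) (hj : m.var x = j)
    (h : HaltsWithin (block l) (m.setCell A j (m.var y)) T Q) :
    HaltsWithin (block (.store A x y :: l)) m (T + 1) Q := by
  rw [add_comm]
  exact cons (T₁ := 1) (R := (· = _)) (store (T := 0) j hj rfl) (by rintro _ - rfl; exact h)

/-- The rule for ascending loops with loop invariant `I`. -/
theorem forUp {i N n : ℕ} (I : ℕ → Memory → Prop) (hi : p.keepsVar i = true)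
    (hN : p.keepsVar N = true) (hiN : i ≠ N) (hn : m.var N = n) (init : I 0 (m.setVar i 0))
    (step : ∀ k < n, ∀ m', SameOff (Prog.forUp i N p) m m' → m'.var i = k → I k m' →
      HaltsWithin p m' T fun m'' => I (k + 1) (m''.setVar i ((k + 1 : ℕ) : ℤ))) :
    HaltsWithin (Prog.forUp i N p) m (n * (T + 2) + 2) (I n) := by
  -- Induction on the number `e` of remaining rounds. A round costs `T` plus one test and one
  -- increment; the failing test at the end costs one more step.
  have key : ∀ e k m', k + e = n → SameOff (Prog.forUp i N p) m m' → m'.var i = k → m'.var N = n →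
      I k m' → HaltsWithin (.loop (.lt i N) (.seq p (.inc i))) m' (e * (T + 2) + 1) (I n) := by
    intro e
    induction e with
    | zero =>
      intro k m' hk _ hik hNn hI
      obtain rfl : k = n := by omega
      exact ⟨1, m', .loop_false (by simp [Test.Holds, hik, hNn]), by omega, hI⟩
    | succ e ih =>
      intro k m' hk hs hik hNn hI
      obtain ⟨t, m₁, he, ht, hI₁⟩ := step k (by omega) m' hs hik hI
      have hs₁ := he.sameOff
      have e1 : m₁.var i = k := (hs₁.var i hi).trans hik
      have e2 : m₁.var N = n := (hs₁.var N hN).trans hNn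
      have hexec : Exec (.seq p (.inc i)) m' (t + 1) (m₁.setVar i ((k + 1 : ℕ) : ℤ)) := by
        have := Exec.inc m₁ i
        rw [e1] at this
        exact .seq he (by exact_mod_cast this)
      obtain ⟨t', m₂, he', ht', hI₂⟩ := ih (k + 1) (m₁.setVar i ((k + 1 : ℕ) : ℤ)) (by omega)
        (hs.trans (hexec.sameOff.weaken (by simp +contextual [Prog.forUp, keepsVar])
          (by simp +contextual [Prog.forUp, keepsArr]))) (by simp) (by simp [hiN.symm, e2]) hI₁
      refine ⟨t + 1 + t' + 1, m₂, .loop_true (by simp [Test.Holds, hik, hNn]; omega) hexec he', ?_,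
        hI₂⟩
      rw [Nat.succ_mul]
      omega
  have h0 : SameOff (Prog.forUp i N p) m (m.setVar i 0) :=
    (Exec.const m i 0).sameOff.weaken (by simp +contextual [Prog.forUp, keepsVar])
      (by simp +contextual [Prog.forUp, keepsArr])
  obtain ⟨t, m', he, ht, hI⟩ := key n 0 (m.setVar i 0) (by omega) h0 (by simp)
    (by simp [hiN.symm, hn]) init
  exact ⟨1 + t, m', .seq (.const m i 0) he, by omega, hI⟩

/-- The rule for descending loops with loop invariant `I`. -/
theorem forDown {i N z n : ℕ} (I : ℕ → Memory → Prop) (hi : p.keepsVar i = true)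
    (hz : p.keepsVar z = true) (hiz : i ≠ z) (hz0 : m.var z = 0) (hn : m.var N = n)
    (init : I n (m.setVar i n))
    (step : ∀ k < n, ∀ m', SameOff (Prog.forDown i N z p) m m' → m'.var i = (k + 1 : ℕ) →
      I (k + 1) m' → HaltsWithin p (m'.setVar i k) T (I k)) :
    HaltsWithin (Prog.forDown i N z p) m (n * (T + 2) + 2) (I 0) := by
  have key : ∀ k m', k ≤ n → SameOff (Prog.forDown i N z p) m m' → m'.var i = k → m'.var z = 0 →
      I k m' → HaltsWithin (.loop (.lt z i) (.seq (.dec i) p)) m' (k * (T + 2) + 1) (I 0) := by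
    intro k
    induction k with
    | zero =>
      intro m' _ _ hik hz' hI
      exact ⟨1, m', .loop_false (by simp [Test.Holds, hik, hz']), by omega, hI⟩
    | succ k ih =>
      intro m' hk hs hik hz' hI
      obtain ⟨t, m₁, he, ht, hI₁⟩ := step k (by omega) m' hs hik hI
      have hs₁ := he.sameOff
      have e1 : m₁.var i = k := by rw [hs₁.var i hi]; simp
      have e2 : m₁.var z = 0 := by rw [hs₁.var z hz]; simp [hiz.symm, hz']
      have hexec : Exec (.seq (.dec i) p) m' (1 + t) m₁ := by
        have := Exec.dec m' i
        rw [hik] at this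
        exact .seq (by simpa using this) he
      obtain ⟨t', m₂, he', ht', hI₂⟩ := ih m₁ (by omega)
        (hs.trans (hexec.sameOff.weaken (by simp +contextual [Prog.forDown, keepsVar])
          (by simp +contextual [Prog.forDown, keepsArr]))) e1 e2 hI₁
      refine ⟨1 + t + t' + 1, m₂, .loop_true (by simp [Test.Holds, hik, hz']) hexec he', ?_,
        hI₂⟩
      rw [Nat.succ_mul]
      omega
  have h0 : SameOff (Prog.forDown i N z p) m (m.setVar i n) := by
    rw [← hn]
    exact (Exec.copy m i N).sameOff.weaken (by simp +contextual [Prog.forDown, keepsVar])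
      (by simp +contextual [Prog.forDown, keepsArr])
  obtain ⟨t, m', he, ht, hI⟩ := key n (m.setVar i n) le_rfl h0 (by simp)
    (by simp [hiz.symm, hz0]) init
  refine ⟨1 + t, m', .seq ?_ he, by omega, hI⟩
  rw [← hn]
  exact .copy m i N

end HaltsWithin

/-! ### The kernel of the Magnus homomorphism -/

section Magnus

variable (r d : ℕ)

/-- A section of the epimorphism onto the free solvable group that sends `1` to `1`. -/
def freeSolvableLift (g : FreeSolvable r d) : FreeGroup (Fin r) :=
  open Classical in if g = 1 then 1 else g.out

theorem toFreeSolvable_lift (g : FreeSolvable r d) :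
    toFreeSolvable r d (freeSolvableLift r d g) = g := by
  unfold freeSolvableLift
  split_ifs with h
  · rw [map_one, h]
  · exact QuotientGroup.out_eq' g

/-- The Schreier element `s(g) u s(gu)⁻¹` of `F^(d)` for the section `s`. -/
def schreier (g : FreeSolvable r d) (u : FreeGroup (Fin r)) :
    derivedSeries (FreeGroup (Fin r)) d :=
  ⟨freeSolvableLift r d g * u * (freeSolvableLift r d (g * toFreeSolvable r d u))⁻¹, by
    rw [← QuotientGroup.eq_one_iff]
    change toFreeSolvable r d _ = 1
    simp [toFreeSolvable_lift]⟩

/-- The factors s(gu)⁻¹ and s(gu) cancel. This is the same cocycle rule that corner entries satisfy.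
-/
theorem schreier_mul (g : FreeSolvable r d) (u v : FreeGroup (Fin r)) :
    schreier r d g (u * v) = schreier r d g u * schreier r d (g * toFreeSolvable r d u) v := by
  ext1
  simp [schreier, mul_assoc]

/-- The additive map sending the edge `g • t_k` to the class of its Schreier generator. -/
def schreierHom : (Fin r → GroupRing (FreeSolvable r d)) →+
    Additive (Abelianization (derivedSeries (FreeGroup (Fin r)) d)) :=
  ∑ k, (((Finsupp.liftAddHom fun g => zmultiplesHom _
    (Additive.ofMul (Abelianization.of (schreier r d g (FreeGroup.of k))))).comp
    (MonoidAlgebra.coeffAddEquiv).toAddMonoidHom).comp (Pi.evalAddMonoidHom _ k))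

theorem schreierHom_single (g : FreeSolvable r d) (k : Fin r) :
    schreierHom r d (MonoidAlgebra.of ℤ _ g • Pi.single k 1) =
      Additive.ofMul (Abelianization.of (schreier r d g (FreeGroup.of k))) := by
  rw [schreierHom, AddMonoidHom.finsetSum_apply, Finset.sum_eq_single k]
  · simp [MonoidAlgebra.one_def]
  · intro b _ hb
    simp [hb]
  · simp

/-- Both sides obey the same cocycle rule in `u` and agree on generators. The base point `g` is
quantified inside because the rule moves it. -/
theorem schreierHom_corner (u : FreeGroup (Fin r)) : ∀ g : FreeSolvable r d,
    schreierHom r d (MonoidAlgebra.of ℤ _ g • (magnusHom r d u).corner) =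
      Additive.ofMul (Abelianization.of (schreier r d g u)) := by
  have hmul : ∀ u v : FreeGroup (Fin r), ∀ g : FreeSolvable r d,
      MonoidAlgebra.of ℤ _ g • (magnusHom r d (u * v)).corner =
        MonoidAlgebra.of ℤ _ (g * toFreeSolvable r d u) • (magnusHom r d v).corner +
          MonoidAlgebra.of ℤ _ g • (magnusHom r d u).corner := by
    intro u v g
    rw [map_mul, TriMatrix.corner_mul, diag_magnusHom, smul_add, smul_smul, ← map_mul]
  induction u using FreeGroup.induction_on with
  | C1 =>
    intro g
    have : schreier r d g 1 = 1 := by ext1; simp [schreier]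
    rw [map_one, TriMatrix.corner_one, smul_zero, map_zero, this, map_one, ofMul_one]
  | of k =>
    intro g
    rw [← schreierHom_single]
    simp [magnusHom]
  | inv_of k ih =>
    intro g
    -- The cocycle rule for x⁻¹x = 1 determines the value at x⁻¹ from the value at x.
    have h1 := hmul (FreeGroup.of k)⁻¹ (FreeGroup.of k) g
    have h2 := schreier_mul r d g (FreeGroup.of k)⁻¹ (FreeGroup.of k)
    have h3 : schreier r d g 1 = 1 := by ext1; simp [schreier]
    rw [inv_mul_cancel, map_one, TriMatrix.corner_one, smul_zero] at h1
    rw [inv_mul_cancel, h3] at h2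
    have h4 := congrArg (schreierHom r d) h1
    have h5 := congrArg (fun x => Additive.ofMul (Abelianization.of x)) h2
    simp only [map_mul, map_one, ofMul_one, ofMul_mul] at h5
    rw [map_zero, map_add, ih] at h4
    exact add_left_cancel (h4.symm.trans (h5.trans (add_comm _ _)))
  | mul u v hu hv =>
    intro g
    rw [hmul, map_add, hu, hv, schreier_mul, map_mul, ofMul_mul, add_comm]

/-- The Magnus embedding is injective: the kernel of `φ : F → M(F/N)` is `N' = F^(d+1)`. -/
theorem ker_magnusHom : (magnusHom r d).ker = derivedSeries (FreeGroup (Fin r)) (d + 1) := by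
  refine le_antisymm (fun u hu => ?_) (derivedSeries_succ_le_ker r d)
  rw [MonoidHom.mem_ker] at hu
  have h1 : toFreeSolvable r d u = 1 := by
    rw [← diag_magnusHom, hu, TriMatrix.diag_one]
  have h2 := schreierHom_corner r d u 1
  rw [hu, TriMatrix.corner_one, smul_zero, map_zero] at h2
  have h3 : Abelianization.of (schreier r d 1 u) = 1 := h2.symm
  have h4 : schreier r d 1 u ∈ commutator (derivedSeries (FreeGroup (Fin r)) d) := by
    rw [← Abelianization.ker_of]; exact h3
  -- Here it matters that the section sends 1 to 1.
  have h5 : ((schreier r d 1 u : derivedSeries (FreeGroup (Fin r)) d) : FreeGroup (Fin r)) = u := by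
    simp [schreier, h1, freeSolvableLift]
  have h6 := Subgroup.mem_map_of_mem (derivedSeries (FreeGroup (Fin r)) d).subtype h4
  rw [Subgroup.map_subtype_commutator] at h6
  rw [derivedSeries_succ]
  simpa [h5] using h6

theorem toFreeSolvable_succ_eq_iff (u v : FreeGroup (Fin r)) :
    toFreeSolvable r (d + 1) u = toFreeSolvable r (d + 1) v ↔ magnusHom r d u = magnusHom r d v := by
  rw [MonoidHom.eq_iff, MonoidHom.eq_iff, ker_magnusHom, toFreeSolvable, QuotientGroup.ker_mk']

/-- The coordinates of the corner entry are the Fox derivatives. -/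
theorem corner_magnusHom (u : FreeGroup (Fin r)) (k : Fin r) :
    (magnusHom r d u).corner k = foxDerivSolvable d k u := by
  let R := GroupRing (FreeSolvable r d)
  let φ := MonoidAlgebra.mapDomainRingHom ℤ (toFreeSolvable r d)
  let a : MagnusGroup r d →* TriMatrix (FreeSolvable r d) R :=
    MonoidHom.mk' (fun A => ⟨A.diag, A.corner k⟩) fun A B => rfl
  let b : TriMatrix (FreeGroup (Fin r)) (GroupRing (FreeGroup (Fin r))) →*
      TriMatrix (FreeSolvable r d) R :=
    MonoidHom.mk' (fun A => ⟨toFreeSolvable r d A.diag, φ A.corner⟩) fun A B => by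
      ext1
      · exact map_mul _ _ _
      · change φ (MonoidAlgebra.of ℤ _ A.diag * B.corner + A.corner) =
          MonoidAlgebra.of ℤ _ (toFreeSolvable r d A.diag) * φ B.corner + φ A.corner
        rw [map_add, map_mul]
        congr 2
        simp [φ]
  -- Taking the k-th coordinate and reducing the Fox matrix modulo F^(d) are homomorphisms on F that
  -- agree on generators.
  have h : a.comp (magnusHom r d) = b.comp (foxMatrix k) := by
    ext1 j
    by_cases hj : j = k
    · subst hj; simp [a, b, magnusHom, foxMatrix]
    · simp [a, b, magnusHom, foxMatrix, hj, Ne.symm hj]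
  have h1 := congrArg TriMatrix.corner (DFunLike.congr_fun h u)
  rw [foxDerivSolvable, MonoidAlgebra.of_apply, foxDeriv_single, one_smul]
  exact h1

end Magnus

/-! ### Least representatives -/

/-- The least `i` with `f i = f j`. -/
def firstIdx {β : Type*} (f : ℕ → β) (j : ℕ) : ℕ := sInf {i | f i = f j}

theorem isLeast_firstIdx {β : Type*} (f : ℕ → β) (j : ℕ) :
    IsLeast {i | f i = f j} (firstIdx f j) :=
  ⟨Nat.sInf_mem (s := {i | f i = f j}) ⟨j, rfl⟩, fun _ hi => Nat.sInf_le hi⟩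

theorem apply_firstIdx {β : Type*} (f : ℕ → β) (j : ℕ) : f (firstIdx f j) = f j :=
  (isLeast_firstIdx f j).1

theorem firstIdx_le {β : Type*} (f : ℕ → β) (j : ℕ) : firstIdx f j ≤ j :=
  (isLeast_firstIdx f j).2 rfl

theorem firstIdx_eq_firstIdx {β : Type*} (f : ℕ → β) {i j : ℕ} :
    firstIdx f i = firstIdx f j ↔ f i = f j := by
  constructor
  · intro h
    rw [← apply_firstIdx f i, h, apply_firstIdx f j]
  · intro h
    rw [firstIdx, h, firstIdx]

theorem firstIdx_eq_of_forall {β : Type*} {f : ℕ → β} {j x : ℕ} (hx : f x = f j)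
    (h : ∀ i < x, f i ≠ f j) : firstIdx f j = x :=
  (isLeast_firstIdx f j).unique ⟨hx, fun i hi => not_lt.1 fun hlt => h i hlt hi⟩

/-- Least representatives depend only on which indices are identified, so labels may be replaced by
any others with the same fibres. -/
theorem firstIdx_congr {β γ : Type*} {f : ℕ → β} {g : ℕ → γ} {j : ℕ}
    (h : ∀ i ≤ j, f i = f j ↔ g i = g j) : firstIdx f j = firstIdx g j :=
  firstIdx_eq_of_forall ((h _ (firstIdx_le g j)).2 (apply_firstIdx g j)) fun i hi hf =>
    hi.not_ge ((isLeast_firstIdx g j).2 ((h i (hi.le.trans (firstIdx_le g j))).1 hf))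

theorem isPartition_firstIdx {r : ℕ} (d : ℕ) (w : Word r) :
    IsPartition d w (firstIdx (prefixElt d w)) := fun j hj =>
  ⟨⟨(firstIdx_le _ j).trans hj, apply_firstIdx _ j⟩, fun _ hi => (isLeast_firstIdx _ j).2 hi.2⟩

/-! ### The flow of a word -/

section Flow

variable {r : ℕ} (d : ℕ) (w : Word r)

/-- The index of the letter number `s` of `w`. -/
def letterIdx (s : ℕ) : ℕ := match w[s]? with
  | none => 0
  | some p => p.1

/-- The exponent of the letter number `s` of `w`. -/
def letterExp (s : ℕ) : ℤ := match w[s]? with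
  | none => 0
  | some p => if p.2 then 1 else -1

/-- The length of the prefix of `w` at which the edge traversed in step `s` starts. -/
def edgeStart (s : ℕ) : ℕ := if letterExp w s = 1 then s else s + 1

theorem letterIdx_lt {s : ℕ} (hs : s < w.length) : letterIdx w s < r := by
  simp [letterIdx, hs]

theorem letterExp_eq {s : ℕ} (hs : s < w.length) : letterExp w s = 1 ∨ letterExp w s = -1 := by
  simp only [letterExp, List.getElem?_eq_getElem hs]
  cases (w[s]).2 <;> simp

theorem letterExp_of_length_le {s : ℕ} (hs : w.length ≤ s) : letterExp w s = 0 := by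
  simp [letterExp, hs]

theorem edgeStart_le {s : ℕ} (hs : s < w.length) : edgeStart w s ≤ w.length := by
  unfold edgeStart
  split_ifs <;> omega

theorem input_arr_zero (k s : ℕ) : (input r d w k).arr 0 s = letterIdx w s := by
  simp only [input, letterIdx]
  rcases w[s]? with _ | p <;> simp

theorem input_arr_one (k s : ℕ) : (input r d w k).arr 1 s = letterExp w s := by
  simp only [input, letterExp]
  rcases w[s]? with _ | p <;> simp

theorem input_arr_of_two_le (k s : ℕ) {A : ℕ} (hA : 2 ≤ A) : (input r d w k).arr A s = 0 := by
  have h0 : A ≠ 0 := by omega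
  have h1 : A ≠ 1 := by omega
  simp only [input, h0, h1, if_false]
  rcases w[s]? with _ | p <;> rfl

/-! ### Flows as coefficients of the Magnus image -/

/-- The number of passages, counted with sign, of the path `w_0, …, w_j` through the edges with
label `g` whose starting point has the colour `v`. -/
def flow {β : Type*} [DecidableEq β] (q : ℕ → β) (g : ℕ) (v : β) (j : ℕ) : ℤ :=
  ∑ s ∈ Finset.range j, if letterIdx w s = g ∧ q (edgeStart w s) = v then letterExp w s else 0

theorem prefixElt_zero (i : ℕ) : prefixElt 0 w i = 1 :=
  (QuotientGroup.eq_one_iff _).2 (by simp)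

/-- Appending x_i to w_j adds w_j t_i, while appending x_i⁻¹ subtracts w_j x_i⁻¹ t_i = w_{j+1} t_i.
This is why an edge traversed backwards starts at the later prefix. -/
theorem corner_magnusHom_take (j : ℕ) (k : Fin r) :
    (magnusHom r d (FreeGroup.mk (w.take j))).corner k =
      ∑ s ∈ Finset.range j, if letterIdx w s = k then
        MonoidAlgebra.single (prefixElt d w (edgeStart w s)) (letterExp w s) else 0 := by
  induction j with
  | zero =>
    rw [List.take_zero, ← FreeGroup.one_eq_mk, map_one]
    simp [TriMatrix.corner_one]
  | succ j ih =>
    rw [Finset.sum_range_succ, ← ih, List.take_add_one, ← FreeGroup.mul_mk, map_mul,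
      TriMatrix.corner_mul, diag_magnusHom, Pi.add_apply, add_comm, Pi.smul_apply]
    congr 1
    by_cases hj : j < w.length
    · rcases hp : w[j] with ⟨i, e⟩
      have hl : letterIdx w j = i := by simp [letterIdx, hj, hp]
      have he : letterExp w j = if e then 1 else -1 := by simp [letterExp, hj, hp]
      have hs : (w[j]?).toList = [(i, e)] := by simp [hj, hp]
      have hik : letterIdx w j = k ↔ i = k := by rw [hl, Fin.val_inj]
      simp only [hik]
      cases e with
      | true =>
        have h1 : (FreeGroup.mk [(i, true)] : FreeGroup (Fin r)) = FreeGroup.of i := rfl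
        have h2 : edgeStart w j = j := by simp [edgeStart, he]
        rw [h2, he, hs, h1]
        by_cases h : i = k
        · subst h; simp [magnusHom, prefixElt]
        · simp [magnusHom, h, Ne.symm h]
      | false =>
        have h1 : (FreeGroup.mk [(i, false)] : FreeGroup (Fin r)) = (FreeGroup.of i)⁻¹ := rfl
        have h2 : prefixElt d w (j + 1) = toFreeSolvable r d (FreeGroup.mk (w.take j)) *
            toFreeSolvable r d (FreeGroup.of i)⁻¹ := by
          rw [prefixElt, List.take_add_one, hs, ← FreeGroup.mul_mk, map_mul, h1]
        have h3 : edgeStart w j = j + 1 := by simp [edgeStart, he]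
        rw [h3, he, hs, h1, h2]
        by_cases h : i = k
        · subst h
          simp [magnusHom, TriMatrix.corner_inv]
        · simp [magnusHom, TriMatrix.corner_inv, h, Ne.symm h]
    · have hs : w[j]?.toList = [] := by simp [not_lt.1 hj]
      rw [hs, ← FreeGroup.one_eq_mk, map_one, TriMatrix.corner_one,
        letterExp_of_length_le w (not_lt.1 hj)]
      simp

open Classical in
theorem coeff_corner_magnusHom_take (j : ℕ) (k : Fin r) (g : FreeSolvable r d) :
    ((magnusHom r d (FreeGroup.mk (w.take j))).corner k).coeff g =
      flow w (prefixElt d w) k g j := by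
  rw [corner_magnusHom_take, MonoidAlgebra.coeff_sum, Finset.sum_apply', flow]
  refine Finset.sum_congr rfl fun s _ => ?_
  by_cases h : letterIdx w s = k
  · simp [h, Finsupp.single_apply]
  · simp [h]

/-- The flow of the prefix `w_j` through the edge traversed in step `t`. -/
def stepFlow (t j : ℕ) : ℤ :=
  flow w (firstIdx (prefixElt d w)) (letterIdx w t)
    (firstIdx (prefixElt d w) (edgeStart w t)) j

-- Partition numbers and group elements distinguish the same vertices, so the flow defined from the
-- partition is the one in the Magnus image.
open Classical in
theorem stepFlow_eq (t j : ℕ) : stepFlow d w t j =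
    flow w (prefixElt d w) (letterIdx w t) (prefixElt d w (edgeStart w t)) j := by
  simp only [stepFlow, flow, firstIdx_eq_firstIdx]

/-- The recursion step of the algorithm: injectivity of the Magnus embedding, with corner entries
compared only at edges that `w` traverses. -/
theorem prefixElt_succ_eq_iff (i j : ℕ) :
    prefixElt (d + 1) w i = prefixElt (d + 1) w j ↔
      prefixElt d w i = prefixElt d w j ∧
        ∀ t < w.length, stepFlow d w t i = stepFlow d w t j := by
  classical
  rw [prefixElt, prefixElt, toFreeSolvable_succ_eq_iff]
  constructor
  · intro h
    refine ⟨?_, fun t ht => ?_⟩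
    · rw [prefixElt, ← diag_magnusHom, h, diag_magnusHom, prefixElt]
    · have := coeff_corner_magnusHom_take d w i ⟨letterIdx w t, letterIdx_lt w ht⟩
        (prefixElt d w (edgeStart w t))
      rw [h, coeff_corner_magnusHom_take] at this
      rw [stepFlow_eq, stepFlow_eq]
      exact this.symm
  · rintro ⟨h0, h⟩
    ext1
    · rw [diag_magnusHom, diag_magnusHom]
      exact h0
    · funext k
      ext g
      rw [coeff_corner_magnusHom_take, coeff_corner_magnusHom_take]
      -- An edge that `w` does not traverse has zero flow for every prefix.
      by_cases hg : ∃ t < w.length, letterIdx w t = k ∧ prefixElt d w (edgeStart w t) = g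
      · obtain ⟨t, ht, hk, rfl⟩ := hg
        have := h t ht
        rwa [stepFlow_eq, stepFlow_eq, hk] at this
      · have h1 : ∀ j, flow w (prefixElt d w) k g j = 0 := by
          intro j
          refine Finset.sum_eq_zero fun s _ => ?_
          split_ifs with hs
          · exact letterExp_of_length_le w (not_lt.1 fun hlt => hg ⟨s, hlt, hs⟩)
          · rfl
        rw [h1, h1]

/-! ### Standard forms of Fox derivatives -/

/-- The terms `(m, v)` of `∂w/∂x_k` with `v < j`. -/
def foxTerms (k j : ℕ) : List (ℤ × ℕ) :=
  ((List.range j).map fun v => (flow w (firstIdx (prefixElt d w)) k v w.length, v)).filter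
    fun p => p.1 ≠ 0

theorem isStandardForm_foxTerms (k : Fin r) :
    IsStandardForm d w (foxTerms d w k (w.length + 1)) (foxDerivSolvable d k (FreeGroup.mk w)) := by
  set P := firstIdx (prefixElt d w) with hP
  refine ⟨?_, ?_, ?_⟩
  · intro p hp
    simp only [foxTerms, List.mem_filter, List.mem_map, List.mem_range] at hp
    obtain ⟨⟨v, hv, rfl⟩, h⟩ := hp
    exact ⟨by simpa using h, by omega⟩
  · refine List.Nodup.map_on ?_ (((List.nodup_range).map fun a b h => (Prod.ext_iff.1 h).2).filter _)
    -- A nonzero flow forces `v` to be a value of the partition function, that is, a least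
    -- representative. Distinct such numbers represent distinct group elements.
    have key : ∀ p ∈ foxTerms d w k (w.length + 1), ∃ s, P s = p.2 := by
      intro p hp
      simp only [foxTerms, List.mem_filter, List.mem_map, List.mem_range] at hp
      obtain ⟨⟨v, hv, rfl⟩, h⟩ := hp
      have h' : flow w P k v w.length ≠ 0 := of_decide_eq_true h
      obtain ⟨s, -, hs⟩ := Finset.exists_ne_zero_of_sum_ne_zero h'
      exact ⟨_, (of_not_not fun h3 => hs (if_neg h3) : _ ∧ P (edgeStart w s) = v).2⟩
    intro p hp q hq h
    have h2 : p.2 = q.2 := by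
      obtain ⟨s, hs⟩ := key p hp
      obtain ⟨t, ht⟩ := key q hq
      rw [← hs, ← ht, hP, apply_firstIdx (prefixElt d w) s,
        apply_firstIdx (prefixElt d w) t] at h
      rw [← hs, ← ht, hP, firstIdx_eq_firstIdx, h]
    simp only [foxTerms, List.mem_filter, List.mem_map, List.mem_range] at hp hq
    obtain ⟨⟨v, -, rfl⟩, -⟩ := hp
    obtain ⟨⟨u, -, rfl⟩, -⟩ := hq
    obtain rfl : v = u := h2
    rfl
  · have h0 := corner_magnusHom_take d w w.length k
    rw [List.take_length, corner_magnusHom] at h0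
    have h1 : ∀ l : List (ℤ × ℕ),
        ((l.filter fun p => p.1 ≠ 0).map fun p =>
          MonoidAlgebra.single (prefixElt d w p.2) p.1).sum =
        (l.map fun p => MonoidAlgebra.single (prefixElt d w p.2) p.1).sum := by
      intro l
      induction l with
      | nil => rfl
      | cons p l ih =>
        by_cases hp : p.1 = 0
        · simpa [hp] using ih
        · simpa [hp] using ih
    rw [h0, foxTerms, h1, List.map_map, ← hP]
    change ∑ v ∈ Finset.range (w.length + 1), _ = _
    -- Step `s` contributes to exactly one `v`, the least representative of its edge start;
    -- exchanging the two sums then recovers the Fox derivative.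
    have h2 : ∀ v, MonoidAlgebra.single (prefixElt d w v) (flow w P k v w.length) =
        ∑ s ∈ Finset.range w.length, if P (edgeStart w s) = v then
          if letterIdx w s = k then
            MonoidAlgebra.single (prefixElt d w (edgeStart w s)) (letterExp w s) else 0 else 0 := by
      intro v
      rw [flow, ← MonoidAlgebra.singleAddHom_apply, map_sum]
      refine Finset.sum_congr rfl fun s _ => ?_
      by_cases h3 : P (edgeStart w s) = v
      · rw [← h3, hP, apply_firstIdx (prefixElt d w) (edgeStart w s)]
        by_cases h4 : letterIdx w s = k <;> simp [h4]
      · simp [h3]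
    simp only [Function.comp_def, h2]
    rw [Finset.sum_comm]
    refine Finset.sum_congr rfl fun s hs => ?_
    rw [Finset.sum_ite_eq, if_pos]
    have := (firstIdx_le (prefixElt d w) (edgeStart w s)).trans
      (edgeStart_le w (Finset.mem_range.1 hs))
    exact Finset.mem_range.2 (Nat.lt_succ_of_le this)

theorem foxTerms_succ (k j : ℕ) : foxTerms d w k (j + 1) =
    if flow w (firstIdx (prefixElt d w)) k j w.length = 0 then foxTerms d w k j
    else foxTerms d w k j ++ [(flow w (firstIdx (prefixElt d w)) k j w.length, j)] := by
  unfold foxTerms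
  rw [List.range_succ, List.map_append, List.filter_append]
  split_ifs with h <;> simp [h]

end Flow

/-! ### The programs

Variables `6`, `7`, `8` hold `0`, `1`, `|w| + 1`. Array `2` holds a partition,
array `6` the classes of the starting points of the edges, array `7` a flow. -/

/-- Computes the classes of the starting points of all edges. -/
def headsProg : Prog :=
  forUp 10 2 <| block [.load 21 1 10, .copy 22 10,
    .ite (.eq 21 7) .skip (.inc 22), .load 18 2 22, .store 6 10 18]

/-- Computes the flows of all prefixes through the edges with label `var 12` and start `var 13`. -/
def flowProg : Prog := block [.store 7 6 6, forUp 14 2 <| block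
  [.load 18 7 14, .load 19 0 14, .load 20 6 14, .load 21 1 14,
    .ite (.eq 19 12) (.ite (.eq 20 13) (.ite (.eq 21 7) (.inc 18) (.dec 18)) .skip) .skip,
    .copy 22 14, .inc 22, .store 7 22 18]]

/-- Refines the partition in array `2` by the values of array `7`. -/
def refineProg : Prog := forDown 15 8 6 <| block
  [.load 18 2 15, .load 19 7 15, .copy 17 15,
    forDown 16 15 6 <| block [.load 20 2 16, .load 21 7 16,
      .ite (.eq 20 18) (.ite (.eq 21 19) (.copy 17 16) .skip) .skip],
    .store 2 15 17]

/-- Passes from the partition for class `c` to that for class `c + 1`. -/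
def levelProg : Prog := block [headsProg, forUp 11 2 <| block
  [.load 12 0 11, .load 13 6 11, flowProg, refineProg]]

/-- Initializes the constants and computes the partition. -/
def partitionProg : Prog :=
  block [.const 7 1, .copy 8 2, .inc 8, forUp 9 1 levelProg]

/-- Appends the standard form of the Fox derivative with respect to the letter `var 12`. -/
def foxTermsProg : Prog := forUp 13 8 <| block
  [flowProg, .load 18 7 2, .ite (.eq 18 6) .skip <| block
    [.store 3 4 18, .store 4 4 13, .inc 4]]

/-- Computes the Fox derivative with respect to the letter `var 3`. -/
def foxProg : Prog := block [partitionProg, headsProg, .copy 12 3, foxTermsProg]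

/-- Computes the image under the Magnus embedding. -/
def magnusProg : Prog := block [partitionProg, headsProg, .copy 5 2,
  forUp 12 0 <| block [.store 5 12 4, foxTermsProg], .store 5 0 4]

/-- The contents of the cells that stay constant during the computation. -/
structure Ready {r : ℕ} (w : Word r) (m : Memory) : Prop where
  length : m.var 2 = w.length
  zero : m.var 6 = 0
  one : m.var 7 = 1
  succ : m.var 8 = (w.length + 1 : ℕ)
  idx : ∀ s, m.arr 0 s = letterIdx w s
  exp : ∀ s, m.arr 1 s = letterExp w s

/-- `p` does not write to the cells that `Ready` is about. -/
def keepsReady (p : Prog) : Bool :=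
  p.keepsVar 2 && p.keepsVar 6 && p.keepsVar 7 && p.keepsVar 8 && p.keepsArr 0 && p.keepsArr 1

/-! ### Correctness and running time of the programs -/

variable {r : ℕ} {w : Word r} {m m' : Memory}

theorem Ready.sameOff {p : Prog} (h : Ready w m) (hs : SameOff p m m')
    (hp : keepsReady p = true) : Ready w m' := by
  simp only [keepsReady, Bool.and_eq_true] at hp
  obtain ⟨⟨⟨⟨⟨h2, h6⟩, h7⟩, h8⟩, h0⟩, h1⟩ := hp
  exact ⟨(hs.var 2 h2).trans h.length, (hs.var 6 h6).trans h.zero, (hs.var 7 h7).trans h.one,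
    (hs.var 8 h8).trans h.succ, fun s => by rw [hs.arr 0 h0, h.idx],
    fun s => by rw [hs.arr 1 h1, h.exp]⟩

theorem Ready.setVar (h : Ready w m) (x : ℕ) (c : ℤ)
    (hx : keepsReady (.const x c) = true) : Ready w (m.setVar x c) :=
  h.sameOff (Exec.const m x c).sameOff hx

theorem haltsWithin_headsProg (h : Ready w m) :
    HaltsWithin headsProg m (w.length * 12 + 2)
      fun m' => ∀ s < w.length, m'.arr 6 s = m.arr 2 (edgeStart w s) := by
  refine HaltsWithin.mono (HaltsWithin.forUp (T := 10)
    (fun k m' => ∀ s < k, m'.arr 6 s = m.arr 2 (edgeStart w s)) rfl rfl (by decide) h.length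
    (by simp) ?_) le_rfl fun _ _ h => h
  intro k hk m₁ hs hik hI
  have hr := h.sameOff hs rfl
  have h2 := hs.arr 2 rfl
  refine .load_cons k hik <| .copy_cons ?_
  refine HaltsWithin.cons (T₁ := 2) (T₂ := 6)
    (R := fun m₂ => m₂.var 22 = edgeStart w k ∧ m₂.arr = m₁.arr ∧ m₂.var 10 = k) ?_ ?_
  · refine .ite (fun hb => .skip ?_) fun hb => .inc ?_ <;>
      simp [Test.Holds, hr.exp, hr.one] at hb <;> simp [edgeStart, hb, hik]
  · rintro m₂ - ⟨h22, harr, h10⟩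
    refine .load_cons _ h22 <| .store_cons k (by simpa using h10) <| .nil ?_
    intro s hs'
    by_cases hsk : s = k
    · subst hsk
      simp [harr, h2]
    · simp [harr, hsk, hI s (by omega)]

theorem haltsWithin_flowProg (h : Ready w m) (q : ℕ → ℕ) (g v : ℕ)
    (hq : ∀ s < w.length, m.arr 6 s = q (edgeStart w s)) (hg : m.var 12 = g) (hv : m.var 13 = v) :
    HaltsWithin flowProg m (w.length * 20 + 10)
      fun m' => ∀ j ≤ w.length, m'.arr 7 j = flow w q g v j := by
  refine HaltsWithin.mono (T₁ := w.length * 20 + 2 + 1 + 1) (.store_cons 0 h.zero <|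
    HaltsWithin.cons (T₂ := 1) (HaltsWithin.forUp (T := 18) (n := w.length)
    (fun k m' => ∀ j ≤ k, m'.arr 7 j = flow w q g v j) rfl rfl (by decide) h.length ?_ ?_)
    fun _ _ h => .nil h) (by omega) fun _ _ h => h
  · simp [flow, h.zero]
  intro k hk m₁ hs hik hI
  have hr : Ready w m₁ := (h.sameOff (Exec.store m 7 6 6 0 h.zero).sameOff rfl).sameOff hs rfl
  have h6 : ∀ s, m₁.arr 6 s = m.arr 6 s := fun s => by rw [hs.arr 6 rfl]; simp
  have h12 : m₁.var 12 = g := by rw [hs.var 12 rfl]; simpa using hg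
  have h13 : m₁.var 13 = v := by rw [hs.var 13 rfl]; simpa using hv
  refine .load_cons k hik <| .load_cons k (by simpa using hik) <|
    .load_cons k (by simpa using hik) <| .load_cons k (by simpa using hik) ?_
  refine HaltsWithin.cons (T₁ := 4) (T₂ := 10)
    (R := fun m₂ => m₂.var 18 = flow w q g v (k + 1) ∧ m₂.arr = m₁.arr ∧ m₂.var 14 = k) ?_ ?_
  · have e1 := hI k le_rfl
    have e2 : flow w q g v (k + 1) = flow w q g v k +
        if letterIdx w k = g ∧ q (edgeStart w k) = v then letterExp w k else 0 :=
      Finset.sum_range_succ _ _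
    -- The exponent is 1 or -1, so the increment or decrement adds exactly the new summand of the
    -- flow.
    rcases letterExp_eq w hk with e3 | e3 <;>
    refine .ite (fun hb => .ite (fun hb' => .ite (fun hb'' => .inc ?_) fun hb'' => .dec ?_)
      fun hb' => .skip ?_) fun hb => .skip ?_ <;>
    simp_all [Test.Holds, hr.exp, hr.one, hr.idx]
    all_goals omega
  · rintro m₂ - ⟨h18, harr, h14⟩
    refine .copy_cons <| .inc_cons <| .store_cons (k + 1) (by simp [h14]) <| .nil ?_
    intro s hs'
    by_cases hsk : s = k + 1
    · subst hsk
      simp [h18]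
    · simp [harr, hsk, hI s (by omega)]

/-- Updating in place is safe because the outer loop descends: when cell `k` is treated, all cells
up to `k` still hold the old partition. The inner loop descends too, so the last match it records is
the least one, with `k` itself as default. -/
theorem haltsWithin_refineProg {β : Type*} (h : Ready w m) (f : ℕ → β)
    (hf : ∀ j ≤ w.length, m.arr 2 j = firstIdx f j) :
    HaltsWithin refineProg m (30 * (w.length + 1) ^ 2)
      fun m' => ∀ j ≤ w.length, m'.arr 2 j = firstIdx (fun i => (f i, m.arr 7 i)) j := by
  set F := fun i => (f i, m.arr 7 i) with hF
  refine HaltsWithin.mono (HaltsWithin.forDown (T := w.length * 10 + 10) (n := w.length + 1)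
    (fun k m' => (∀ j < k, m'.arr 2 j = m.arr 2 j) ∧
      ∀ j, k ≤ j → j ≤ w.length → m'.arr 2 j = firstIdx F j) rfl rfl (by decide) h.zero h.succ
    ⟨fun _ _ => rfl, fun j h1 h2 => by omega⟩ ?_) (by nlinarith)
    fun m' _ hm' j hj => hm'.2 j (Nat.zero_le j) hj
  rintro k hk m₁ hs hik ⟨hlt, hge⟩
  have hr := h.sameOff hs rfl
  have h7 : ∀ s, m₁.arr 7 s = m.arr 7 s := fun s => by rw [hs.arr 7 rfl]
  have hP : ∀ i ≤ k, m₁.arr 2 i = firstIdx f i := fun i hi => by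
    rw [hlt i (by omega), hf i (by omega)]
  refine HaltsWithin.mono (T₁ := k * 8 + 2 + 2 + 3) (.load_cons k (by simp) <|
    .load_cons k (by simp) <| .copy_cons <|
    HaltsWithin.cons (T₂ := 2) (HaltsWithin.forDown (T := 6) (n := k)
    (fun l m₂ => ∃ x : ℕ, m₂.var 17 = x ∧ x ≤ k ∧ F x = F k ∧ ∀ i, l ≤ i → i < x → F i ≠ F k)
    rfl rfl (by decide) (by simp [hr.zero]) (by simp)
    ⟨k, by simp, le_rfl, rfl, fun i h1 h2 => by omega⟩ ?_) ?_) (by omega) fun _ _ h => h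
  · rintro l hl m₂ hs₂ hil ⟨x, hx, hxk, hFx, hx'⟩
    have e2 : ∀ s, m₂.arr 2 s = m₁.arr 2 s := fun s => by rw [hs₂.arr 2 rfl]; simp
    have e7 : ∀ s, m₂.arr 7 s = m₁.arr 7 s := fun s => by rw [hs₂.arr 7 rfl]; simp
    have e18 : m₂.var 18 = firstIdx f k := by rw [hs₂.var 18 rfl]; simp [hP k le_rfl]
    have e19 : m₂.var 19 = m.arr 7 k := by rw [hs₂.var 19 rfl]; simp [h7]
    have hFl : F l = F k ↔ m₂.arr 2 l = m₂.var 18 ∧ m₂.arr 7 l = m₂.var 19 := by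
      rw [e2, e7, e18, e19, hP l hl.le, h7, Nat.cast_inj, firstIdx_eq_firstIdx, hF]
      exact Prod.ext_iff
    have hno : F l ≠ F k → ∃ y : ℕ, m₂.var 17 = y ∧ y ≤ k ∧ F y = F k ∧
        ∀ i, l ≤ i → i < y → F i ≠ F k := fun hne =>
      ⟨x, hx, hxk, hFx, fun i h1 h2 => by
        rcases h1.eq_or_lt with rfl | h1
        · exact hne
        · exact hx' i h1 h2⟩
    refine .load_cons l (by simp) <| .load_cons l (by simp) ?_
    refine HaltsWithin.cons (T₁ := 3) (T₂ := 1) ?_ fun _ _ h => .nil h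
    refine .ite (fun hb => .ite (fun hb' => .copy ?_) fun hb' => .skip ?_) fun hb => .skip ?_
    · simp only [Test.Holds] at hb hb'
      refine ⟨l, by simp, hl.le, hFl.2 ⟨by simpa using hb, by simpa using hb'⟩,
        fun i h1 h2 => by omega⟩
    · simpa using hno fun h => hb' (by simpa [Test.Holds] using (hFl.1 h).2)
    · simpa using hno fun h => hb (by simpa [Test.Holds] using (hFl.1 h).1)
  · rintro m₂ hs₂ ⟨x, hx, hxk, hFx, hx'⟩
    have e2 : ∀ s, m₂.arr 2 s = m₁.arr 2 s := fun s => by rw [hs₂.arr 2 rfl]; simp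
    refine .store_cons k (by rw [hs₂.var 15 rfl]; simp) <| .nil ⟨fun j hj => ?_, fun j hj hj' => ?_⟩
    · simp [hj.ne, e2, hlt j (by omega)]
    · by_cases hjk : j = k
      · subst hjk
        rw [firstIdx_eq_of_forall hFx fun i hi => hx' i (Nat.zero_le i) hi]
        simp [hx]
      · simp [hjk, e2, hge j (by omega) hj']

theorem haltsWithin_levelProg (h : Ready w m) (c : ℕ)
    (hP : ∀ j ≤ w.length, m.arr 2 j = firstIdx (prefixElt c w) j) :
    HaltsWithin levelProg m (100 * (w.length + 1) ^ 3)
      fun m' => ∀ j ≤ w.length, m'.arr 2 j = firstIdx (prefixElt (c + 1) w) j := by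
  set P := firstIdx (prefixElt c w) with hPdef
  -- After `t` rounds the partition is that of the class-`c` element together with the flows through
  -- the first `t` traversed edges; later flows are masked by 0.
  let F : ℕ → ℕ → FreeSolvable r c × (ℕ → ℤ) := fun t j =>
    (prefixElt c w j, fun t' => if t' < t then stepFlow c w t' j else 0)
  have hF : ∀ t i j, F t i = F t j ↔ prefixElt c w i = prefixElt c w j ∧
      ∀ t' < t, stepFlow c w t' i = stepFlow c w t' j := by
    intro t i j
    simp only [F, Prod.mk.injEq, funext_iff]
    refine and_congr_right fun _ => forall_congr' fun t' => ?_
    by_cases ht : t' < t <;> simp [ht]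
  refine HaltsWithin.mono (HaltsWithin.cons (T₂ := w.length * (30 * (w.length + 1) ^ 2 +
    (w.length * 20 + 10) + 3 + 2) + 2 + 1) (haltsWithin_headsProg h)
    fun m₁ hs₁ h6 => HaltsWithin.cons (HaltsWithin.forUp
    (T := 30 * (w.length + 1) ^ 2 + (w.length * 20 + 10) + 3)
    (fun t m' => ∀ j ≤ w.length, m'.arr 2 j = firstIdx (F t) j)
    rfl rfl (by decide) (h.sameOff hs₁ rfl).length ?_ ?_) fun m₂ _ h₂ => .nil ?_) ?_ fun _ _ h => h
  · intro j hj
    rw [Memory.setVar_arr, hs₁.arr 2 rfl, hP j hj, hPdef]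
    exact congrArg _ (firstIdx_congr fun i _ => by simp [hF])
  · intro t ht m₂ hs₂ hit hI
    have hr₁ := h.sameOff hs₁ rfl
    have hr := hr₁.sameOff hs₂ rfl
    -- Array 6 was filled before any refinement, so flows are always taken with respect to the
    -- class-`c` partition although array 2 changes.
    have hQ : ∀ s < w.length, m₂.arr 6 s = P (edgeStart w s) := fun s hs => by
      rw [hs₂.arr 6 rfl, h6 s hs, hP _ (edgeStart_le w hs)]
    refine HaltsWithin.mono (T₁ := (w.length * 20 + 10) + (30 * (w.length + 1) ^ 2 + 1) + 1 + 1)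
      (.load_cons t hit <| .load_cons t (by simpa using hit) <|
      HaltsWithin.cons (haltsWithin_flowProg ((hr.setVar 12 _ rfl).setVar 13 _ rfl) P
        (letterIdx w t) (P (edgeStart w t)) hQ (by simp [hr.idx]) (by simp [hQ t ht])) fun m₃ hs₃ h7 =>
      HaltsWithin.cons (haltsWithin_refineProg
        (((hr.setVar 12 _ rfl).setVar 13 _ rfl).sameOff hs₃ rfl)
        (F t) fun j hj => ?_) fun m₄ _ h2 => .nil ?_) (by omega) fun _ _ h => h
    · rw [hs₃.arr 2 rfl]
      exact hI j hj
    · intro j hj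
      rw [Memory.setVar_arr, h2 j hj]
      -- Pairing `F t` with the flow just computed has the same fibres as `F (t + 1)`.
      refine congrArg _ (firstIdx_congr fun i hi => ?_)
      rw [Prod.mk.injEq, h7 i (hi.trans hj), h7 j hj, hF, hF, Nat.forall_lt_succ_right, and_assoc]
      rfl
  · intro j hj
    rw [h₂ j hj]
    exact congrArg _ (firstIdx_congr fun i _ => by rw [hF, prefixElt_succ_eq_iff])
  · nlinarith [Nat.zero_le w.length, Nat.zero_le (w.length ^ 2), Nat.zero_le (w.length ^ 3)]

theorem haltsWithin_partitionProg (r d : ℕ) (w : Word r) (k : ℕ) :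
    HaltsWithin partitionProg (input r d w k) (d * (100 * (w.length + 1) ^ 3 + 2) + 6)
      fun m' => Ready w m' ∧ ∀ j ≤ w.length, m'.arr 2 j = firstIdx (prefixElt d w) j := by
  set m₀ : Memory := (((input r d w k).setVar 7 1).setVar 8 w.length).setVar 8 (w.length + 1 : ℕ)
    with hm₀
  have hr : Ready w m₀ := ⟨by simp [m₀, input], by simp [m₀, input], by simp [m₀],
    by simp [m₀], input_arr_zero d w k, input_arr_one d w k⟩
  refine .const_cons <| .copy_cons <| .inc_cons ?_
  have e : ∀ m₁ : Memory, m₁ = m₀ → HaltsWithin (block [forUp 9 1 levelProg]) m₁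
      (d * (100 * (w.length + 1) ^ 3 + 2) + 3)
      fun m' => Ready w m' ∧ ∀ j ≤ w.length, m'.arr 2 j = firstIdx (prefixElt d w) j := by
    rintro _ rfl
    refine HaltsWithin.cons (T₂ := 1) (HaltsWithin.forUp (T := 100 * (w.length + 1) ^ 3)
      (fun c m' => ∀ j ≤ w.length, m'.arr 2 j = firstIdx (prefixElt c w) j)
      rfl rfl (by decide) (by simp [m₀, input]) ?_ ?_) fun m₁ hs h => .nil ⟨hr.sameOff hs rfl, h⟩
    · intro j _
      -- In class 0 all prefixes coincide, and the zero-initialized array 2 already is this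
      -- partition.
      rw [firstIdx_eq_of_forall (x := 0) (by simp [prefixElt_zero]) (by simp)]
      exact input_arr_of_two_le d w k j le_rfl
    · intro c _ m₁ hs _ hI
      exact haltsWithin_levelProg (hr.sameOff hs rfl) c hI
  apply e
  simp [m₀, input]

/-! ### Output of Fox derivatives and of the Magnus image -/

/-- The arrays `3` and `4` hold the list `L`, and variable `4` its length. -/
def Holds (L : List (ℤ × ℕ)) (m : Memory) : Prop :=
  m.var 4 = L.length ∧ ∀ (t : ℕ) (ht : t < L.length), m.arr 3 t = L[t].1 ∧ m.arr 4 t = L[t].2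

/-- The result of `headsProg` for the partition for class `d`. -/
def HasHeads (d : ℕ) (w : Word r) (m : Memory) : Prop :=
  ∀ s < w.length, m.arr 6 s = firstIdx (prefixElt d w) (edgeStart w s)

/-- The list `L` already present is arbitrary, so that the same program can append the coordinates
of the Magnus image one after another. -/
theorem haltsWithin_foxTermsProg (h : Ready w m) (d k : ℕ) (hk : m.var 12 = k)
    (hQ : HasHeads d w m) (L : List (ℤ × ℕ)) (hL : Holds L m) :
    HaltsWithin foxTermsProg m (50 * (w.length + 1) ^ 2)
      (Holds (L ++ foxTerms d w k (w.length + 1))) := by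
  set n := w.length with hn
  refine HaltsWithin.mono (HaltsWithin.forUp (T := (n * 20 + 10) + 7)
    (fun v m' => Holds (L ++ foxTerms d w k v) m') rfl rfl (by decide) h.succ ?_ ?_)
    (by nlinarith) fun _ _ h => h
  · simpa [foxTerms, Holds] using hL
  · intro v hv m₁ hs hiv hI
    have hr := h.sameOff hs rfl
    refine HaltsWithin.cons (haltsWithin_flowProg hr (firstIdx (prefixElt d w)) k v
      (fun s hs' => by rw [hs.arr 6 rfl]; exact hQ s hs') ((hs.var 12 rfl).trans hk) hiv)
      fun m₂ hs₂ h7 => ?_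
    have hr₂ := hr.sameOff hs₂ rfl
    have h7 := h7 n le_rfl
    have hH : Holds (L ++ foxTerms d w k v) m₂ := by
      rw [Holds, hs₂.var 4 rfl, hs₂.arr 3 rfl, hs₂.arr 4 rfl]
      exact hI
    refine .load_cons n hr₂.length ?_
    refine HaltsWithin.cons (T₁ := 5) (T₂ := 1) (.ite (fun hb => .skip ?_) fun hb =>
      .store_cons (L ++ foxTerms d w k v).length (by simpa using hH.1) <|
      .store_cons (L ++ foxTerms d w k v).length (by simpa using hH.1) <| .inc_cons <| .nil ?_)
      fun _ _ h => .nil h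
    · simp only [Test.Holds, Memory.setVar_var, h7, hr₂.zero] at hb
      rw [foxTerms_succ, if_pos (by simpa using hb)]
      simpa [Holds] using hH
    · simp only [Test.Holds, Memory.setVar_var, h7, hr₂.zero] at hb
      rw [foxTerms_succ, if_neg (by simpa using hb), ← List.append_assoc]
      set L' := L ++ foxTerms d w k v
      have h13 : m₂.var 13 = v := (hs₂.var 13 rfl).trans hiv
      refine ⟨by simp [hH.1], fun t ht => ?_⟩
      rw [List.length_append, List.length_singleton] at ht
      by_cases htL : t < L'.length
      · simp [List.getElem_append_left htL, htL.ne, hH.2 t htL]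
      · obtain rfl : t = L'.length := by omega
        simpa [h13] using h7

theorem haltsWithin_partition_heads {l : List Prog} {T : ℕ} {Q : Memory → Prop} (r d : ℕ)
    (w : Word r) (k : ℕ)
    (h : ∀ m', SameOff (.seq partitionProg headsProg) (input r d w k) m' → Ready w m' →
      HasHeads d w m' → HaltsWithin (block l) m' T Q) :
    HaltsWithin (block (partitionProg :: headsProg :: l)) (input r d w k)
      (d * (100 * (w.length + 1) ^ 3 + 2) + 6 + (w.length * 12 + 2 + T)) Q := by
  refine HaltsWithin.cons (haltsWithin_partitionProg r d w k) fun m₁ hs₁ ⟨hr₁, hP₁⟩ =>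
    HaltsWithin.cons (haltsWithin_headsProg hr₁) fun m₂ hs₂ h6 =>
    h m₂ ?_ (hr₁.sameOff hs₂ rfl) fun s hs => ?_
  · exact (hs₁.weaken (by simp +contextual [keepsVar]) (by simp +contextual [keepsArr])).trans
      (hs₂.weaken (by simp +contextual [keepsVar]) (by simp +contextual [keepsArr]))
  · rw [h6 s hs, hP₁ _ (edgeStart_le w hs)]

theorem holds_nil {p : Prog} {d k : ℕ} (h : SameOff p (input r d w k) m)
    (hp : p.keepsVar 4 = true) : Holds [] m :=
  ⟨by rw [h.var 4 hp]; simp [input], fun t ht => absurd ht (by simp)⟩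

theorem haltsWithin_foxProg (r d : ℕ) (w : Word r) (k : Fin r) :
    HaltsWithin foxProg (input r d w k)
      (d * (100 * (w.length + 1) ^ 3 + 2) + 6 + (w.length * 12 + 2 +
        (50 * (w.length + 1) ^ 2 + 2)))
      (OutputsFoxDeriv d w k) := by
  refine haltsWithin_partition_heads r d w k fun m₁ hs hr h6 => .copy_cons <|
    HaltsWithin.cons (T₂ := 1) (haltsWithin_foxTermsProg (hr.setVar 12 _ rfl) d k ?_ h6 [] ?_)
    fun m₂ _ hH => .nil ⟨0, foxTerms d w k (w.length + 1), rfl, ?_, isStandardForm_foxTerms d w k,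
      ?_⟩
  · rw [Memory.setVar_var, if_pos rfl, hs.var 3 rfl]
    simp [input]
  · simpa [Holds] using holds_nil hs rfl
  · simpa using hH.1
  · simpa using hH.2

theorem haltsWithin_magnusProg (r d : ℕ) (w : Word r) :
    HaltsWithin magnusProg (input r d w 0)
      (d * (100 * (w.length + 1) ^ 3 + 2) + 6 + (w.length * 12 + 2 +
        (r * (50 * (w.length + 1) ^ 2 + 2 + 2) + 5)))
      (OutputsMatrix w (magnusEmbedding r d (toFreeSolvable r (d + 1) (FreeGroup.mk w)))) := by
  -- The output after the first `k` coordinates; its length is the offset stored in cell `k` of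
  -- array 5.
  let terms : ℕ → List (ℤ × ℕ) := fun k =>
    (List.range k).flatMap fun i => foxTerms d w i (w.length + 1)
  have hterms : ∀ k, terms (k + 1) = terms k ++ foxTerms d w k (w.length + 1) := fun k => by
    simp [terms, List.range_succ]
  have hprefix : ∀ k l, ∃ L, terms (k + l) = terms k ++ L := by
    intro k l
    induction l with
    | zero => exact ⟨[], by simp⟩
    | succ l ih =>
      obtain ⟨L, hL⟩ := ih
      exact ⟨_, by rw [← add_assoc, hterms, hL, List.append_assoc]⟩
  refine haltsWithin_partition_heads r d w 0 fun m₁ hs hr h6 => .copy_cons <|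
    HaltsWithin.cons (T₁ := r * (50 * (w.length + 1) ^ 2 + 2 + 2) + 2) (T₂ := 2)
    (HaltsWithin.forUp (T := 50 * (w.length + 1) ^ 2 + 2)
      (fun k m' => Holds (terms k) m' ∧ ∀ i < k, m'.arr 5 i = (terms i).length)
      rfl rfl (by decide) ?_ ?_ ?_) fun m₂ hs₂ hI => .store_cons r ?_ <| .nil ?_
  · rw [Memory.setVar_var, if_neg (by decide), hs.var 0 rfl]
    simp [input]
  · exact ⟨by simpa [Holds, terms] using holds_nil hs rfl, by simp⟩
  · rintro k hk m₂ hs₂ hik ⟨hH, h5⟩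
    have h4 : m₂.var 4 = (terms k).length := hH.1
    have hr₂ := (hr.setVar 5 (m₁.var 2) rfl).sameOff hs₂ rfl
    refine HaltsWithin.mono (T₁ := 50 * (w.length + 1) ^ 2 + 1 + 1) (.store_cons k hik <|
      HaltsWithin.cons (T₂ := 1) (haltsWithin_foxTermsProg
        (hr₂.sameOff (Exec.store m₂ 5 12 4 k hik).sameOff rfl) d k hik (fun s hs' => ?_) (terms k)
        (by simpa [Holds] using hH)) fun m₃ hs₃ hH' => .nil ⟨?_, fun i hi => ?_⟩) le_rfl fun _ _ h => h
    · have := h6 s hs'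
      rw [← Memory.setVar_arr m₁ 5 (m₁.var 2), ← hs₂.arr 6 rfl] at this
      simpa using this
    · rw [hterms]
      simpa [Holds] using hH'
    · rw [Memory.setVar_arr, hs₃.arr 5 rfl]
      by_cases hik : i = k
      · subst hik; simp [h4]
      · simp [hik, h5 i (by omega)]
  · rw [hs₂.var 0 rfl, Memory.setVar_var, if_neg (by decide), hs.var 0 rfl]
    simp [input]
  · obtain ⟨hH, h5⟩ := hI
    change OutputsMatrix w (magnusHom r d (FreeGroup.mk w)) _
    refine ⟨⟨w.length, le_rfl, ?_, ?_⟩, fun i => ?_⟩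
    · rw [Memory.setCell_var, hs₂.var 5 rfl, Memory.setVar_var, if_pos rfl, hr.length]
    · rw [diag_magnusHom, prefixElt, List.take_length]
    · have h5' : ∀ i ≤ r, (m₂.setCell 5 r (m₂.var 4)).arr 5 i = (terms i).length := by
        intro i hi
        rcases hi.eq_or_lt with rfl | hi
        · simp [hH.1]
        · simp [hi.ne, h5 i hi]
      refine ⟨(terms i).length, foxTerms d w i (w.length + 1), h5' _ i.2.le, ?_, ?_, fun t ht => ?_⟩
      · rw [h5' _ i.2, hterms]
        simp
      · rw [corner_magnusHom]
        exact isStandardForm_foxTerms d w i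
      · obtain ⟨L, hL⟩ := hprefix (i + 1) (r - (i + 1))
        rw [Nat.add_sub_cancel' (Nat.succ_le_of_lt i.2), hterms, List.append_assoc] at hL
        have hget : ∀ (L₁ L₂ L₃ L : List (ℤ × ℕ)), L = L₁ ++ (L₂ ++ L₃) → Holds L m₂ →
            ∀ (t : ℕ) (ht : t < L₂.length), m₂.arr 3 (L₁.length + t) = L₂[t].1 ∧
              m₂.arr 4 (L₁.length + t) = L₂[t].2 := by
          rintro L₁ L₂ L₃ _ rfl hL t ht
          have := hL.2 (L₁.length + t) (by simp; omega)
          simpa [List.getElem_append, ht] using this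
        simpa using hget _ _ _ _ hL hH t ht

/-- Every summand is at most a constant times d r (n + 1)³, with constants adding up to less than
200, and n + 1 ≤ 2 max(1, n) gives a factor 8. This bound dominates the times of all three programs.
-/
theorem time_bound {d r : ℕ} (hr : 2 ≤ r) (hd : 2 ≤ d) (n : ℕ) :
    d * (100 * (n + 1) ^ 3 + 2) + 6 + (n * 12 + 2 + (r * (50 * (n + 1) ^ 2 + 2 + 2) + 5)) ≤
      1600 * (d * r * max 1 n ^ 3) := by
  have h1 : (n + 1) ^ 3 ≤ (2 * max 1 n) ^ 3 := Nat.pow_le_pow_left (by omega) 3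
  have h2 : n + 1 ≤ (n + 1) ^ 3 := Nat.le_self_pow (by omega) _
  have hX : d * r * (n + 1) ^ 3 ≤ 8 * (d * r * max 1 n ^ 3) := by
    calc d * r * (n + 1) ^ 3 ≤ d * r * (2 * max 1 n) ^ 3 := by gcongr
      _ = _ := by ring
  have a1 : d * 1 * (n + 1) ^ 3 ≤ d * r * (n + 1) ^ 3 := by gcongr; omega
  have a2 : 1 * r * (n + 1) ^ 2 ≤ d * r * (n + 1) ^ 3 := by gcongr <;> omega
  have a3 : d * 1 * 1 ≤ d * r * (n + 1) ^ 3 := by gcongr <;> omega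
  have a4 : 1 * r * 1 ≤ d * r * (n + 1) ^ 3 := by gcongr <;> omega
  have a5 : 1 * 1 * (n + 1) ≤ d * r * (n + 1) ^ 3 := by gcongr <;> omega
  have e1 : d * (100 * (n + 1) ^ 3 + 2) = 100 * (d * 1 * (n + 1) ^ 3) + 2 * (d * 1 * 1) := by ring
  have e2 : r * (50 * (n + 1) ^ 2 + 2 + 2) = 50 * (1 * r * (n + 1) ^ 2) + 4 * (1 * r * 1) := by
    ring
  omega

end FoxComplexity

end

theorem mainTheorem7 :
    -- the `S_{r,d}`-partition of the set of prefixes of `w`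
    (∃ (p : FoxComplexity.Prog) (C : ℕ), ∀ (r d : ℕ), 2 ≤ r → 2 ≤ d →
      ∀ w : FoxComplexity.Word r,
        FoxComplexity.HaltsWithin p (FoxComplexity.input r d w 0)
          (C * (d * r * max 1 w.length ^ 3))
          (FoxComplexity.OutputsPartition d w)) ∧
    -- the Fox derivative of `w` with respect to `x_k` in the group ring of `S_{r,d}`
    (∃ (p : FoxComplexity.Prog) (C : ℕ), ∀ (r d : ℕ), 2 ≤ r → 2 ≤ d →
      ∀ (w : FoxComplexity.Word r) (k : Fin r),
        FoxComplexity.HaltsWithin p (FoxComplexity.input r d w k)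
          (C * (d * r * max 1 w.length ^ 3))
          (FoxComplexity.OutputsFoxDeriv d w k)) ∧
    -- the image of the class of `w` in `S_{r,d+1}` under the Magnus embedding
    (∃ (p : FoxComplexity.Prog) (C : ℕ), ∀ (r d : ℕ), 2 ≤ r → 2 ≤ d →
      ∀ w : FoxComplexity.Word r,
        FoxComplexity.HaltsWithin p (FoxComplexity.input r d w 0)
          (C * (d * r * max 1 w.length ^ 3))
          (FoxComplexity.OutputsMatrix w (FoxComplexity.magnusEmbedding r d
            (FoxComplexity.toFreeSolvable r (d + 1) (FreeGroup.mk w))))) := by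
  open FoxComplexity in
  refine ⟨⟨partitionProg, 1600, fun r d hr hd w => ?_⟩,
    ⟨foxProg, 1600, fun r d hr hd w k => ?_⟩, ⟨magnusProg, 1600, fun r d hr hd w => ?_⟩⟩
  · exact (haltsWithin_partitionProg r d w 0).mono (le_trans (by omega)
      (time_bound hr hd w.length)) fun m' _ h => ⟨_, isPartition_firstIdx d w, h.2⟩
  · refine (haltsWithin_foxProg r d w k).mono (le_trans ?_ (time_bound hr hd w.length))
      fun m' _ h => h
    have : 1 * (50 * (w.length + 1) ^ 2 + 2 + 2) ≤ r * (50 * (w.length + 1) ^ 2 + 2 + 2) :=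
      Nat.mul_le_mul_right _ (by omega)
    omega
  · exact (haltsWithin_magnusProg r d w).mono (time_bound hr hd w.length) fun m' _ h => h
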